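/- Let $q\ge 3$ be a prime power, let $\mathbb F_q$ be the finite field with $q$ elements, and let $n\ge 2$ be an integer. Call a matrix $A\in M_n(\mathbb F_q)$ *cyclic* if there is a vector $v\in\mathbb F_q^n$ such that $v,Av,\ldots,A^{n-1}v$ generate $\mathbb F_q^n$, and call it *semisimple* if its minimal polynomial is a product of distinct monic irreducible separable polynomials in $\mathbb F_q[x]$. Then every matrix in $M_n(\mathbb F_q)$ is (a) a sum of two invertible cyclic matrices in $M_n(\mathbb F_q)$; and (b) a sum of two invertible semisimple matrices in $M_n(\mathbb F_q)$. -/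

import Mathlib

/-- A matrix `A` over a commutative ring `R` is cyclic if some vector `v` is such that
`v, A v, …, A ^ (m - 1) v` generate the `R`-module `R ^ m`. -/
def Matrix.IsCyclicMatrix {R : Type*} [CommRing R] {m : ℕ} (A : Matrix (Fin m) (Fin m) R) : Prop :=
  ∃ v : Fin m → R,
    Submodule.span R (Set.range fun i : Fin m => (A ^ (i : ℕ)).mulVec v) = ⊤

/-- A matrix over a field is semisimple if its minimal polynomial is a product of distinct monic
polynomials, each of them irreducible and separable. -/
def Matrix.IsSemisimpleMatrix {K : Type*} [Field K] {m : ℕ} (A : Matrix (Fin m) (Fin m) K) : Prop :=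
  ∃ s : Finset (Polynomial K),
    (∀ f ∈ s, f.Monic ∧ Irreducible f ∧ f.Separable) ∧ minpoly K A = ∏ f ∈ s, f

/-!
A Hessenberg matrix with no zero on its subdiagonal is cyclic. Hence, to write `A` as a sum of two
invertible cyclic matrices, conjugate it to Hessenberg form and split each subdiagonal entry into
two nonzero summands. Adding `t` to the top right corner of one summand and subtracting it from the
other preserves this shape and changes both determinants by nonzero multiples of `t`, so each
excludes only one value of `t`.

For semisimple summands, decomposing the `K[X]`-module `K ^ n` into cyclic ones reduces to the
companion matrix `C(p)` of a monic `p`. If `P` is monic of the same degree and its subleading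
coefficient exceeds that of `p` by `μ ≠ 0`, then `d = C(p) - C(P)` has rank one and `d² = μ d`. Thus
`C(p) = (l + d) + (C(P) - l)`, where the first summand is a root of `(X - l) (X - l - μ)` and, for
`P = Q(X - l)`, the second one is a root of `Q`. A separable trinomial
`Q = X ^ (k + 2) + s X ^ (k + 1) + c` leaves enough freedom to prescribe the subleading coefficient.
-/

open Matrix Polynomial UniqueFactorizationMonoid

section Hessenberg

variable {R K : Type*} [CommRing R] [Field K] {m : ℕ}

/-- The matrices all of whose entries below the first subdiagonal vanish. -/
def IsUpperHessenberg (H : Matrix (Fin m) (Fin m) R) : Prop :=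
  ∀ ⦃i j : Fin m⦄, (j : ℕ) + 1 < i → H i j = 0

/-- The upper Hessenberg matrices without a zero on the first subdiagonal. They are the matrices of
a cyclic endomorphism in a basis adapted to the flag of a cyclic vector. -/
structure IsUnreducedHessenberg (H : Matrix (Fin m) (Fin m) R) : Prop where
  isUpperHessenberg : IsUpperHessenberg H
  ne_zero : ∀ ⦃i j : Fin m⦄, (i : ℕ) = j + 1 → H i j ≠ 0

theorem IsUnreducedHessenberg.pow_apply_zero [IsDomain R]
    {H : Matrix (Fin (m + 1)) (Fin (m + 1)) R} (hH : IsUnreducedHessenberg H) (k : ℕ) :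
    (∀ i : Fin (m + 1), k < i → (H ^ k) i 0 = 0) ∧
      ∀ i : Fin (m + 1), (i : ℕ) = k → (H ^ k) i 0 ≠ 0 := by
  induction k with
  | zero =>
    refine ⟨fun i hi => ?_, fun i hi => ?_⟩
    · rw [pow_zero]
      exact one_apply_ne (Fin.pos_iff_ne_zero.mp hi)
    · obtain rfl : i = 0 := Fin.ext hi
      simp
  | succ k ih =>
    obtain ⟨hzero, hne⟩ := ih
    rw [pow_succ']
    refine ⟨fun i hi => ?_, fun i hi => ?_⟩ <;> rw [mul_apply]
    · refine Finset.sum_eq_zero fun j _ => ?_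
      rcases lt_or_ge k (j : ℕ) with hj | hj
      · rw [hzero j hj, mul_zero]
      · rw [hH.isUpperHessenberg (by omega), zero_mul]
    · let l : Fin (m + 1) := ⟨k, by omega⟩
      rw [Finset.sum_eq_single l]
      · exact mul_ne_zero (hH.ne_zero hi) (hne l rfl)
      · intro j _ hj
        rcases lt_or_gt_of_ne (Fin.val_ne_iff.mpr hj) with hlt | hgt
        · rw [hH.isUpperHessenberg (by simp only [l] at hlt; omega), zero_mul]
        · rw [hzero j hgt, mul_zero]
      · exact fun h => absurd (Finset.mem_univ l) h

theorem IsUnreducedHessenberg.isCyclicMatrix {H : Matrix (Fin (m + 1)) (Fin (m + 1)) K}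
    (hH : IsUnreducedHessenberg H) : H.IsCyclicMatrix := by
  let krylov : Matrix (Fin (m + 1)) (Fin (m + 1)) K := of fun i j => (H ^ (j : ℕ)) i 0
  have htri : krylov.IsUpperTriangular := fun i j hij => (hH.pow_apply_zero j).1 i hij
  have hunit : IsUnit krylov := by
    rw [isUnit_iff_isUnit_det, det_of_isUpperTriangular htri, isUnit_iff_ne_zero]
    exact Finset.prod_ne_zero_iff.mpr fun i _ => (hH.pow_apply_zero i).2 i rfl
  refine ⟨Pi.single 0 1, ?_⟩
  have hcol : (fun j : Fin (m + 1) => (H ^ (j : ℕ)) *ᵥ Pi.single 0 1) = krylov.col := by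
    funext j
    exact mulVec_single_one _ _
  rw [hcol]
  exact (linearIndependent_cols_iff_isUnit.mpr hunit).span_eq_top_of_card_eq_finrank' (by simp)

theorem IsUnreducedHessenberg.add_single {H : Matrix (Fin (m + 1)) (Fin (m + 1)) R}
    (hH : IsUnreducedHessenberg H) (j : Fin (m + 1)) (t : R) :
    IsUnreducedHessenberg (H + single 0 j t) := by
  have hrow {i : Fin (m + 1)} (hi : 0 < (i : ℕ)) (l : Fin (m + 1)) :
      (H + single 0 j t : Matrix _ _ R) i l = H i l := by
    rw [Matrix.add_apply, single_apply_of_row_ne (by rintro rfl; exact hi.false), add_zero]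
  exact ⟨fun i l hil => (hrow (by omega) l).trans (hH.isUpperHessenberg hil),
    fun i l hil => by rw [hrow (by omega)]; exact hH.ne_zero hil⟩

theorem det_add_single {n : Type*} [Fintype n] [DecidableEq n] (A : Matrix n n R) (i j : n)
    (t : R) : (A + single i j t).det = A.det + t * A.adjugate j i := by
  have hrow : A + single i j t = A.updateRow i (A i + t • Pi.single j 1) := by
    ext k l
    rcases eq_or_ne k i with rfl | hk
    · simp [single_apply, Pi.single_apply, eq_comm]
    · simp [updateRow_ne hk, single_apply_of_row_ne hk.symm]
  rw [hrow, det_updateRow_add, updateRow_eq_self, det_updateRow_smul, adjugate_apply]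

theorem IsUpperHessenberg.adjugate_last_zero {H : Matrix (Fin (m + 1)) (Fin (m + 1)) R}
    (hH : IsUpperHessenberg H) :
    H.adjugate (Fin.last m) 0 = (-1) ^ m * ∏ i : Fin m, H i.succ i.castSucc := by
  have htri : (H.submatrix Fin.succ Fin.castSucc).IsUpperTriangular := fun i j hij =>
    hH (by simpa using hij)
  simp [adjugate_fin_succ_eq_det_submatrix, Fin.succAbove_last, Fin.succAbove_zero,
    det_of_isUpperTriangular htri]

theorem IsUnreducedHessenberg.exists_forall_ne_isUnit_add_single
    {H : Matrix (Fin (m + 1)) (Fin (m + 1)) K} (hH : IsUnreducedHessenberg H) :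
    ∃ t₀ : K, ∀ t ≠ t₀, IsUnit (H + single 0 (Fin.last m) t) := by
  let c := H.adjugate (Fin.last m) 0
  have hc : c ≠ 0 := by
    simp only [c, hH.isUpperHessenberg.adjugate_last_zero]
    exact mul_ne_zero (pow_ne_zero m (neg_ne_zero.mpr one_ne_zero))
      (Finset.prod_ne_zero_iff.mpr fun i _ => hH.ne_zero (by simp))
  refine ⟨-H.det / c, fun t ht => ?_⟩
  rw [isUnit_iff_isUnit_det, det_add_single, isUnit_iff_ne_zero]
  contrapose! ht
  rw [eq_div_iff hc]
  exact eq_neg_of_add_eq_zero_right ht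

theorem IsUpperHessenberg.exists_add_isUnreducedHessenberg (hK : 3 ≤ Cardinal.mk K)
    {H : Matrix (Fin m) (Fin m) K} (hH : IsUpperHessenberg H) :
    ∃ B C, IsUnreducedHessenberg B ∧ IsUnreducedHessenberg C ∧ H = B + C := by
  choose β hβ hβ' using Cardinal.exists_ne_ne_of_three_le hK (0 : K)
  let B : Matrix (Fin m) (Fin m) K := of fun i j => if (i : ℕ) = j + 1 then β (H i j) else 0
  have hB : IsUpperHessenberg B := fun i j hij => if_neg (by omega)
  have hBsub {i j : Fin m} (hij : (i : ℕ) = j + 1) : B i j = β (H i j) := if_pos hij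
  refine ⟨B, H - B, ⟨hB, fun i j hij => ?_⟩, ⟨fun i j hij => ?_, fun i j hij => ?_⟩,
    (add_sub_cancel B H).symm⟩
  · rw [hBsub hij]
    exact hβ _
  · rw [Matrix.sub_apply, hH hij, hB hij, sub_zero]
  · rw [Matrix.sub_apply, hBsub hij]
    exact sub_ne_zero.mpr (hβ' _).symm

theorem IsUpperHessenberg.exists_add_isUnit_isCyclicMatrix (hK : 3 ≤ Cardinal.mk K)
    {H : Matrix (Fin (m + 1)) (Fin (m + 1)) K} (hH : IsUpperHessenberg H) :
    ∃ B C : Matrix (Fin (m + 1)) (Fin (m + 1)) K,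
      (IsUnit B ∧ B.IsCyclicMatrix) ∧ (IsUnit C ∧ C.IsCyclicMatrix) ∧ H = B + C := by
  obtain ⟨B, C, hB, hC, rfl⟩ := hH.exists_add_isUnreducedHessenberg hK
  obtain ⟨b, hb⟩ := hB.exists_forall_ne_isUnit_add_single
  obtain ⟨c, hc⟩ := hC.exists_forall_ne_isUnit_add_single
  obtain ⟨t, htb, htc⟩ := Cardinal.exists_ne_ne_of_three_le hK b (-c)
  refine ⟨B + single 0 (Fin.last m) t, C + single 0 (Fin.last m) (-t),
    ⟨hb t htb, (hB.add_single _ t).isCyclicMatrix⟩,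
    ⟨hc (-t) fun h => htc (neg_eq_iff_eq_neg.mp h), (hC.add_single _ (-t)).isCyclicMatrix⟩, ?_⟩
  rw [← single_neg]
  abel

open Set Submodule in
theorem exists_linearIndependent_hessenberg {V : Type*} [AddCommGroup V] [Module K V]
    (f : Module.End K V) {m : ℕ} (hm : m ≤ Module.finrank K V) :
    ∃ v : Fin m → V, LinearIndependent K v ∧
      ∀ j : Fin m, (j : ℕ) + 1 < m → f (v j) ∈ span K (v '' {i | (i : ℕ) ≤ j + 1}) := by
  induction m with
  | zero => exact ⟨Fin.elim0, linearIndependent_empty_type, fun j => j.elim0⟩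
  | succ m ih =>
    obtain ⟨v, hv, hf⟩ := ih (by omega)
    -- `f (v (m - 1))` if this is a new direction, and any new direction otherwise.
    obtain ⟨w, hw, hfw⟩ : ∃ w, w ∉ span K (range v) ∧
        ∀ j : Fin m, (j : ℕ) + 1 = m → f (v j) ∈ span K (insert w (range v)) := by
      by_cases hlast : ∃ j : Fin m, (j : ℕ) + 1 = m ∧ f (v j) ∉ span K (range v)
      · obtain ⟨j, hj, hfj⟩ := hlast
        refine ⟨f (v j), hfj, fun i hi => ?_⟩
        obtain rfl : i = j := Fin.ext (by omega)
        exact subset_span (mem_insert _ _)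
      · push Not at hlast
        obtain ⟨w, hw⟩ := exists_linearIndependent_snoc_of_lt_finrank hv hm
        exact ⟨w, (linearIndependent_finSnoc.mp hw).2,
          fun j hj => span_mono (subset_insert _ _) (hlast j hj)⟩
    refine ⟨Fin.snoc v w, linearIndependent_finSnoc.mpr ⟨hv, hw⟩, fun j hj => ?_⟩
    obtain ⟨j, rfl⟩ := j.exists_castSucc_eq.mpr (by rintro rfl; simp at hj)
    rw [Fin.snoc_castSucc]
    rcases lt_or_eq_of_le (show (j : ℕ) + 1 ≤ m from j.isLt) with hlt | heq
    · refine span_mono ?_ (hf j hlt)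
      rintro _ ⟨i, hi, rfl⟩
      exact ⟨i.castSucc, hi, Fin.snoc_castSucc (α := fun _ => V) w v i⟩
    · refine span_mono ?_ (hfw j heq)
      rw [← Fin.range_snoc]
      rintro _ ⟨i, rfl⟩
      exact mem_image_of_mem _ (i.is_le.trans_eq heq.symm)

theorem exists_isUpperHessenberg_conj (A : Matrix (Fin m) (Fin m) K) :
    ∃ P : GL (Fin m) K, IsUpperHessenberg (P⁻¹.val * A * P.val) := by
  obtain ⟨v, hv, hAv⟩ := exists_linearIndependent_hessenberg (toLin' A) (m := m) (by simp)
  let b := basisOfLinearIndependentOfCardEqFinrank' v hv (by simp)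
  have hb : ⇑b = v := coe_basisOfLinearIndependentOfCardEqFinrank' v hv _
  let e := Pi.basisFun K (Fin m)
  let P : GL (Fin m) K := ⟨e.toMatrix b, b.toMatrix e, e.toMatrix_mul_toMatrix_flip b,
    b.toMatrix_mul_toMatrix_flip e⟩
  have hP : P⁻¹.val * A * P.val = LinearMap.toMatrix b b (toLin' A) := by
    rw [← basis_toMatrix_mul_linearMap_toMatrix_mul_basis_toMatrix b e b e (toLin' A),
      ← toLin_eq_toLin', LinearMap.toMatrix_toLin]
    rfl
  refine ⟨P, fun i j hij => ?_⟩
  rw [hP, LinearMap.toMatrix_apply]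
  by_contra hne
  rw [← hb] at hAv
  have hsupport := b.repr_support_subset_of_mem_span _ (hAv j (by omega))
  exact hij.not_ge (hsupport (Finsupp.mem_support_iff.mpr hne))

theorem isCyclicMatrix_conj {A : Matrix (Fin m) (Fin m) R} (hA : A.IsCyclicMatrix)
    (P : GL (Fin m) R) : (P.val * A * P⁻¹.val).IsCyclicMatrix := by
  obtain ⟨v, hv⟩ := hA
  have hpow (i : ℕ) : (P.val * A * P⁻¹.val) ^ i *ᵥ (P.val *ᵥ v) = P.val *ᵥ (A ^ i *ᵥ v) := by
    rw [Units.conj_pow, mulVec_mulVec, mulVec_mulVec, Units.inv_mul_cancel_right]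
  have hsurj : Function.Surjective P.val.mulVecLin := mulVec_surjective_iff_isUnit.mpr P.isUnit
  refine ⟨P.val *ᵥ v, ?_⟩
  simp only [hpow]
  have := congrArg (Submodule.map P.val.mulVecLin) hv
  rwa [Submodule.map_span, ← Set.range_comp, Submodule.map_top,
    LinearMap.range_eq_top.mpr hsurj] at this

end Hessenberg

theorem exists_add_isUnit_isCyclicMatrix {K : Type*} [Field K] (hK : 3 ≤ Cardinal.mk K) {n : ℕ}
    (A : Matrix (Fin n) (Fin n) K) : ∃ B C : Matrix (Fin n) (Fin n) K,
      (IsUnit B ∧ B.IsCyclicMatrix) ∧ (IsUnit C ∧ C.IsCyclicMatrix) ∧ A = B + C := by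
  rcases n with _ | m
  · have hzero : IsUnit (0 : Matrix (Fin 0) (Fin 0) K) ∧
        (0 : Matrix (Fin 0) (Fin 0) K).IsCyclicMatrix :=
      ⟨isUnit_of_subsingleton _, 0, Subsingleton.elim _ _⟩
    exact ⟨0, 0, hzero, hzero, Subsingleton.elim _ _⟩
  obtain ⟨P, hP⟩ := exists_isUpperHessenberg_conj A
  obtain ⟨B, C, ⟨hB, hBc⟩, ⟨hC, hCc⟩, hBC⟩ := hP.exists_add_isUnit_isCyclicMatrix hK
  refine ⟨P.val * B * P⁻¹.val, P.val * C * P⁻¹.val,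
    ⟨(P.isUnit.mul hB).mul P⁻¹.isUnit, isCyclicMatrix_conj hBc P⟩,
    ⟨(P.isUnit.mul hC).mul P⁻¹.isUnit, isCyclicMatrix_conj hCc P⟩, ?_⟩
  rw [← add_mul, ← mul_add, ← hBC]
  simp [mul_assoc]

section Separable

variable {K A B : Type*} [Field K] [Ring A] [Algebra K A] [Ring B] [Algebra K B]

theorem separable_radical [DecidableEq K] {p : K[X]} (hp : ∀ f ∈ primeFactors p, f.Separable) :
    (radical p).Separable :=
  separable_prod' (fun _ hf _ hg hfg => (pairwise_primeFactors_isRelPrime hf hg hfg).isCoprime) hp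

theorem isSeparable_of_aeval_eq_zero {a : A} {p : K[X]} (hp : p.Separable)
    (ha : aeval a p = 0) : IsSeparable K a :=
  hp.of_dvd (minpoly.dvd K a ha)

theorem isUnit_of_aeval_eq_zero {a : A} {p : K[X]} (ha : aeval a p = 0) (hp : p.eval 0 ≠ 0) :
    IsUnit a := by
  have hcomm : Commute a (aeval a p.divX) := by
    simpa using (Commute.all X p.divX).map (aeval a)
  have hmul : a * aeval a p.divX = -algebraMap K A (p.eval 0) := by
    have h := congrArg (aeval a) (X_mul_divX_add p)
    rw [ha, map_add, map_mul, aeval_X, aeval_C, coeff_zero_eq_eval_zero] at h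
    exact eq_neg_of_add_eq_zero_left h
  have hunit : IsUnit (a * aeval a p.divX) := by
    rw [hmul, IsUnit.neg_iff]
    exact (IsUnit.mk0 _ hp).map (algebraMap K A)
  exact (hcomm.isUnit_mul_iff.mp hunit).1

theorem isSeparable_map {a : A} (ha : IsSeparable K a) (φ : A →ₐ[K] B) : IsSeparable K (φ a) :=
  isSeparable_of_aeval_eq_zero ha (by rw [aeval_algHom_apply, minpoly.aeval, map_zero])

theorem isSeparable_pi {ι : Type*} [Finite ι] {A : ι → Type*} [∀ i, Ring (A i)]
    [∀ i, Algebra K (A i)] {a : ∀ i, A i} (ha : ∀ i, IsSeparable K (a i)) : IsSeparable K a := by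
  classical
  have := Fintype.ofFinite ι
  let p := ∏ i, minpoly K (a i)
  have hp : p ≠ 0 := Finset.prod_ne_zero_iff.mpr fun i _ => (ha i).ne_zero
  have hsep : (radical p).Separable := by
    refine separable_radical fun f hf => ?_
    obtain ⟨hprime, -, hdvd⟩ := (mem_normalizedFactors_iff' hp).mp (mem_primeFactors.mp hf)
    obtain ⟨i, -, hi⟩ := (hprime.prime.dvd_finsetProd_iff _).mp hdvd
    exact (ha i).of_dvd hi
  refine isSeparable_of_aeval_eq_zero hsep (funext fun i => ?_)
  have hdvd : minpoly K (a i) ∣ radical p :=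
    (dvd_radical_iff (ha i).squarefree.isRadical hp).mpr
      (Finset.dvd_prod_of_mem _ (Finset.mem_univ i))
  exact (aeval_algHom_apply (Pi.evalAlgHom K A i) a (radical p)).symm.trans
    (aeval_eq_zero_of_dvd_aeval_eq_zero hdvd (minpoly.aeval K (a i)))

theorem isSemisimpleMatrix_of_isSeparable {m : ℕ} {A : Matrix (Fin m) (Fin m) K}
    (hA : IsSeparable K A) : A.IsSemisimpleMatrix := by
  classical
  have hmonic : (minpoly K A).Monic := minpoly.monic (Algebra.IsIntegral.isIntegral A)
  refine ⟨primeFactors (minpoly K A), fun f hf => ?_, ?_⟩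
  · obtain ⟨hirr, hnorm, hdvd⟩ :=
      (mem_normalizedFactors_iff' hA.ne_zero).mp (mem_primeFactors.mp hf)
    exact ⟨hnorm ▸ monic_normalize hirr.ne_zero, hirr, hA.of_dvd hdvd⟩
  · have hrad : radical (minpoly K A) = normalize (minpoly K A) := by
      rw [radical, ← prod_normalizedFactors_eq hA.ne_zero,
        ← primeFactors_val_eq_normalizedFactors hA.squarefree.isRadical, Finset.prod_val]
    exact (hrad.trans hmonic.normalize_eq_self).symm

variable (K) in
/-- The elements of a `K`-algebra that are a sum of two units with separable minimal polynomials.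
For matrices this is the decomposition sought; the general form lets it be transported along
arbitrary homomorphisms of `K`-algebras. -/
def IsSumOfSeparableUnits (a : A) : Prop :=
  ∃ b c : A, (IsUnit b ∧ IsSeparable K b) ∧ (IsUnit c ∧ IsSeparable K c) ∧ a = b + c

namespace IsSumOfSeparableUnits

protected theorem map {a : A} (ha : IsSumOfSeparableUnits K a) (φ : A →ₐ[K] B) :
    IsSumOfSeparableUnits K (φ a) := by
  obtain ⟨b, c, ⟨hb, hb'⟩, ⟨hc, hc'⟩, rfl⟩ := ha
  exact ⟨φ b, φ c, ⟨hb.map φ, isSeparable_map hb' φ⟩, ⟨hc.map φ, isSeparable_map hc' φ⟩,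
    map_add φ b c⟩

protected theorem pi {ι : Type*} [Finite ι] {A : ι → Type*} [∀ i, Ring (A i)] [∀ i, Algebra K (A i)]
    {a : ∀ i, A i} (ha : ∀ i, IsSumOfSeparableUnits K (a i)) : IsSumOfSeparableUnits K a := by
  choose b c hb hc hbc using ha
  exact ⟨b, c, ⟨Pi.isUnit_iff.mpr fun i => (hb i).1, isSeparable_pi fun i => (hb i).2⟩,
    ⟨Pi.isUnit_iff.mpr fun i => (hc i).1, isSeparable_pi fun i => (hc i).2⟩, funext hbc⟩

theorem of_aeval_eq_zero {b c : A} {p q : K[X]} (hp : p.Separable) (hp₀ : p.eval 0 ≠ 0)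
    (hb : aeval b p = 0) (hq : q.Separable) (hq₀ : q.eval 0 ≠ 0) (hc : aeval c q = 0) :
    IsSumOfSeparableUnits K (b + c) :=
  ⟨b, c, ⟨isUnit_of_aeval_eq_zero hb hp₀, isSeparable_of_aeval_eq_zero hp hb⟩,
    ⟨isUnit_of_aeval_eq_zero hc hq₀, isSeparable_of_aeval_eq_zero hq hc⟩, rfl⟩

protected theorem algebraMap (hK : 3 ≤ Cardinal.mk K) (a : K) :
    IsSumOfSeparableUnits K (algebraMap K A a) := by
  obtain ⟨b, hb, hba⟩ := Cardinal.exists_ne_ne_of_three_le hK 0 a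
  rw [← add_sub_cancel b a, map_add]
  exact of_aeval_eq_zero (separable_X_sub_C (x := b)) (by simpa using hb) (by simp)
    (separable_X_sub_C (x := a - b)) (by simpa [sub_eq_zero] using hba) (by simp)

end IsSumOfSeparableUnits

end Separable

section Polynomial

variable {K : Type*} [Field K]

theorem coeff_comp_X_add_C {R : Type*} [CommRing R] {p : R[X]} {m : ℕ}
    (hp : p.natDegree = m + 1) (r : R) :
    (p.comp (X + C r)).coeff m = p.coeff m + (m + 1) * p.leadingCoeff * r := by
  have hdeg : (hasseDeriv m p).natDegree ≤ 1 :=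
    (natDegree_hasseDeriv_le p m).trans (by omega)
  rw [← taylor_apply, taylor_coeff, eq_X_add_C_of_natDegree_le_one hdeg]
  simp [hasseDeriv_coeff, leadingCoeff, hp, add_comm]

theorem isCoprime_X_sub_C {p : K[X]} {r : K} (hp : p.eval r ≠ 0) : IsCoprime p (X - C r) :=
  ((irreducible_X_sub_C r).coprime_iff_not_dvd.mpr (by rwa [dvd_iff_isRoot])).symm

theorem isCoprime_C_mul_X_add_C {p : K[X]} {a b : K} (hab : a ≠ 0 ∨ b ≠ 0)
    (hp : a ≠ 0 → p.eval (-b / a) ≠ 0) : IsCoprime p (C a * X + C b) := by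
  rcases eq_or_ne a 0 with rfl | ha
  · have hunit : IsUnit (C b) := isUnit_C.mpr (hab.resolve_left (not_not.mpr rfl)).isUnit
    rw [C_0, zero_mul, zero_add]
    exact isCoprime_one_right.of_isCoprime_of_dvd_right (isUnit_iff_dvd_one.mp hunit)
  · have hfactor : C a * X + C b = C a * (X - C (-b / a)) := by
      rw [mul_sub, ← C_mul, mul_div_cancel₀ _ ha, C_neg, sub_neg_eq_add]
    rw [hfactor, isCoprime_mul_unit_left_right (isUnit_C.mpr ha.isUnit)]
    exact isCoprime_X_sub_C (hp ha)

theorem exists_monic_separable (hK : 3 ≤ Cardinal.mk K) (k : ℕ) {s : K}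
    (hs : (k + 2 : K) ≠ 0 ∨ s ≠ 0) :
    ∃ Q : K[X], Q.Monic ∧ Q.natDegree = k + 2 ∧ Q.coeff (k + 1) = s ∧ Q.Separable ∧
      Q.eval 0 ≠ 0 := by
  -- The root of the linear factor of `derivative Q`; that factor has none if `k + 2 = 0` in `K`,
  -- and then `r = 0`.
  let r : K := -((k + 1) * s) / (k + 2)
  obtain ⟨c, hc, hcr⟩ :=
    Cardinal.exists_ne_ne_of_three_le hK 0 (-(r ^ (k + 2) + s * r ^ (k + 1)))
  let Q : K[X] := X ^ (k + 2) + C s * X ^ (k + 1) + C c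
  have hderiv : derivative Q = X ^ k * (C (k + 2 : K) * X + C ((k + 1) * s)) := by
    simp only [Q, derivative_add, derivative_X_pow, derivative_C_mul, derivative_C, C_mul, C_add,
      map_natCast, C_1, C_ofNat]
    push_cast
    ring
  have hQ₀ : Q.eval 0 ≠ 0 := by simpa [Q] using hc
  have hX : IsCoprime Q X := by simpa using isCoprime_X_sub_C hQ₀
  have hlinear : IsCoprime Q (C (k + 2 : K) * X + C ((k + 1) * s)) := by
    refine isCoprime_C_mul_X_add_C (or_iff_not_imp_left.mpr fun hk => ?_) fun _ hr => hcr ?_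
    · rw [show (k + 1 : K) = -1 by linear_combination not_not.mp hk]
      simpa using hs.resolve_left hk
    · rw [← add_eq_zero_iff_eq_neg']
      simpa [Q] using hr
  have hsep : Q.Separable := by
    rw [Separable, hderiv]
    exact hX.pow_right.mul_right hlinear
  exact ⟨Q, by simp only [Q]; monicity!, by simp only [Q]; compute_degree!,
    by simp [Q, coeff_X_pow], hsep, hQ₀⟩

theorem exists_monic_separable_comp (hK : 3 ≤ Cardinal.mk K) (k : ℕ) (t : K) :
    ∃ (Q : K[X]) (l μ : K), Q.Separable ∧ Q.eval 0 ≠ 0 ∧ l ≠ 0 ∧ μ ≠ 0 ∧ l + μ ≠ 0 ∧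
      (Q.comp (X - C l)).Monic ∧ (Q.comp (X - C l)).natDegree = k + 2 ∧
      (Q.comp (X - C l)).coeff (k + 1) = t + μ := by
  obtain ⟨μ, hμ, hμt⟩ := Cardinal.exists_ne_ne_of_three_le hK 0 (-t)
  obtain ⟨l, hl, hlμ⟩ := Cardinal.exists_ne_ne_of_three_le hK 0 (-μ)
  have hs : (k + 2 : K) ≠ 0 ∨ t + μ + (k + 2) * l ≠ 0 := by
    refine or_iff_not_imp_left.mpr fun hn h => hμt ?_
    rw [not_not.mp hn] at h
    linear_combination h
  obtain ⟨Q, hmonic, hdeg, hcoeff, hsep, hQ₀⟩ := exists_monic_separable hK k hs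
  refine ⟨Q, l, μ, hsep, hQ₀, hl, hμ, fun h => hlμ (eq_neg_of_add_eq_zero_left h),
    hmonic.comp_X_sub_C l, by rw [natDegree_comp, hdeg, natDegree_X_sub_C, mul_one], ?_⟩
  rw [sub_eq_add_neg, ← C_neg, coeff_comp_X_add_C hdeg, hcoeff, hmonic.leadingCoeff]
  push_cast
  ring

end Polynomial

section Companion

variable {R K : Type*} [CommRing R] [Field K]

/-- The companion matrix of `X ^ n + ∑ i < n, p.coeff i * X ^ i`, with the coefficients in the last
column; only the coefficients of `p` below degree `n` matter. -/
def companion (n : ℕ) (p : R[X]) : Matrix (Fin n) (Fin n) R :=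
  of fun i j => if (j : ℕ) + 1 = n then -p.coeff i else if (i : ℕ) = j + 1 then 1 else 0

theorem aeval_companion {n : ℕ} {p : R[X]} (hp : p.Monic) (hn : p.natDegree = n) :
    aeval (companion n p) p = 0 := by
  subst hn
  nontriviality R
  let pb := AdjoinRoot.powerBasis' hp
  have hgen : pb.minpolyGen = p := by
    rw [pb.minpolyGen_eq]
    refine (minpoly.unique' R pb.gen hp (AdjoinRoot.eval₂_root p) fun q hq => ?_).symm
    refine or_iff_not_imp_left.mpr fun hq₀ h => (pb.dim_le_degree_of_root hq₀ h).not_gt ?_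
    rwa [degree_eq_natDegree hp.ne_zero] at hq
  have hroot : Algebra.leftMulMatrix pb.basis pb.gen = companion pb.dim p := by
    rw [pb.leftMulMatrix, hgen]
    rfl
  have h : aeval (companion pb.dim p) p = 0 := by
    rw [← hroot, aeval_algHom_apply, show aeval pb.gen p = 0 from AdjoinRoot.eval₂_root p, map_zero]
  exact h

theorem mul_self_companion_sub_companion (m : ℕ) (p q : R[X]) :
    (companion (m + 1) p - companion (m + 1) q) * (companion (m + 1) p - companion (m + 1) q) =
      (q.coeff m - p.coeff m) • (companion (m + 1) p - companion (m + 1) q) := by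
  let u : Fin (m + 1) → R := fun i => q.coeff i - p.coeff i
  have hrank_one : companion (m + 1) p - companion (m + 1) q =
      vecMulVec u (Pi.single (Fin.last m) 1) := by
    ext i j
    rcases eq_or_ne j (Fin.last m) with rfl | hj
    · simp only [companion, u, Matrix.sub_apply, of_apply, Fin.val_last, if_true, vecMulVec_apply,
        Pi.single_eq_same, mul_one, neg_sub_neg]
    · have hj' : (j : ℕ) ≠ m := fun h => hj (Fin.ext h)
      simp [companion, u, vecMulVec_apply, hj, hj']
  rw [hrank_one, vecMulVec_mul_vecMulVec, vecMulVec_smul]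
  simp [u]

theorem isSumOfSeparableUnits_companion (hK : 3 ≤ Cardinal.mk K) (n : ℕ) (p : K[X]) :
    IsSumOfSeparableUnits K (companion n p) := by
  rcases n with _ | _ | k
  · rw [Subsingleton.elim (companion 0 p) (algebraMap K _ 0)]
    exact .algebraMap hK 0
  · have hscalar : companion 1 p = algebraMap K _ (-p.coeff 0) := by
      ext i j
      simp [companion, Subsingleton.elim i j, Subsingleton.elim j 0, algebraMap_matrix_apply]
    rw [hscalar]
    exact .algebraMap hK _
  obtain ⟨Q, l, μ, hQ, hQ₀, hl, hμ, hlμ, hmonic, hdeg, hcoeff⟩ :=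
    exists_monic_separable_comp hK k (p.coeff (k + 1))
  let P := Q.comp (X - C l)
  let d := companion (k + 2) p - companion (k + 2) P
  have hd : d * d = μ • d := by
    simp only [d, mul_self_companion_sub_companion, P, hcoeff, add_sub_cancel_left]
  have hb : aeval (algebraMap K _ l + d) ((X - C l) * (X - C (l + μ))) = 0 := by
    simp only [map_mul, map_sub, aeval_X, aeval_C, map_add, add_sub_cancel_left,
      add_sub_add_left_eq_sub]
    rw [mul_sub, hd, ← Algebra.commutes, Algebra.smul_def, sub_self]
  have hc : aeval (companion (k + 2) P - algebraMap K _ l) Q = 0 := by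
    simpa [P, aeval_comp] using aeval_companion hmonic hdeg
  have hsep : ((X - C l) * (X - C (l + μ))).Separable :=
    separable_X_sub_C.mul separable_X_sub_C
      (isCoprime_X_sub_C_of_isUnit_sub (by simpa using hμ))
  have heval : ((X - C l) * (X - C (l + μ))).eval 0 = l * (l + μ) := by
    simp only [eval_mul, eval_sub, eval_X, eval_C, zero_sub, neg_mul_neg]
  have hsum : companion (k + 2) p =
      (algebraMap K _ l + d) + (companion (k + 2) P - algebraMap K _ l) := by
    simp only [d]
    abel
  rw [hsum]
  exact .of_aeval_eq_zero hsep (heval ▸ mul_ne_zero hl hlμ) hb hQ hQ₀ hc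

theorem isSumOfSeparableUnits_lmul_gen (hK : 3 ≤ Cardinal.mk K) {S : Type*} [CommRing S]
    [Algebra K S] (pb : PowerBasis K S) :
    IsSumOfSeparableUnits K (Algebra.lmul K S pb.gen) := by
  have h := (isSumOfSeparableUnits_companion hK pb.dim pb.minpolyGen).map
    (toLinAlgEquiv pb.basis).toAlgHom
  have hgen : companion pb.dim pb.minpolyGen = Algebra.leftMulMatrix pb.basis pb.gen :=
    pb.leftMulMatrix.symm
  rw [hgen] at h
  exact (toLin_toMatrix pb.basis pb.basis (Algebra.lmul K S pb.gen)) ▸ h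

end Companion

section EndPi

/-- The algebra homomorphism by which a family of endomorphisms acts componentwise on a product
of modules. -/
def endPiAlgHom (K : Type*) {ι : Type*} (V : ι → Type*) [CommSemiring K]
    [∀ i, AddCommMonoid (V i)] [∀ i, Module K (V i)] :
    (∀ i, Module.End K (V i)) →ₐ[K] Module.End K (∀ i, V i) where
  toFun := LinearMap.piMap
  map_one' := rfl
  map_mul' _ _ := rfl
  map_zero' := rfl
  map_add' _ _ := rfl
  commutes' _ := rfl

variable {K V : Type*} [Field K] [AddCommGroup V] [Module K V]

theorem isSumOfSeparableUnits_end [FiniteDimensional K V] (hK : 3 ≤ Cardinal.mk K)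
    (f : Module.End K V) : IsSumOfSeparableUnits K f := by
  obtain ⟨ι, _, p, hp, e, ⟨φ⟩⟩ := Module.equiv_directSum_of_isTorsion
    (Module.AEval.isTorsion_of_finiteDimensional (K := K) (M := V) (a := f))
  let q i := p i ^ e i
  let W : ι → Type _ := fun i => K[X] ⧸ K[X] ∙ q i
  have hW (i : ι) : IsSumOfSeparableUnits K (Algebra.lsmul K K (W i) (X : K[X])) :=
    isSumOfSeparableUnits_lmul_gen hK (AdjoinRoot.powerBasis (pow_ne_zero (e i) (hp i).ne_zero))
  let ψ : Module.AEval' f ≃ₗ[K[X]] ∀ i, W i := φ ≪≫ₗ DirectSum.linearEquivFunOnFintype K[X] ι _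
  have hpi : IsSumOfSeparableUnits K (Algebra.lsmul K K (∀ i, W i) (X : K[X])) :=
    IsSumOfSeparableUnits.map (B := Module.End K (∀ i, W i)) (.pi hW) (endPiAlgHom K W)
  let χ := Module.AEval'.of f ≪≫ₗ ψ.restrictScalars K
  have hχ : χ.symm.conj (Algebra.lsmul K K (∀ i, W i) (X : K[X])) = f := by
    ext x
    simp only [χ, LinearEquiv.conj_apply_apply, LinearEquiv.symm_symm, Algebra.lsmul_coe]
    rw [LinearEquiv.symm_apply_eq]
    simp [← Module.AEval'.X_smul_of]
  have h := hpi.map (χ.symm.conjAlgEquiv K).toAlgHom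
  exact hχ ▸ h

end EndPi

theorem theorem1p5_general {K : Type*} [Field K] (hK : 3 ≤ Cardinal.mk K) {n : ℕ}
    (A : Matrix (Fin n) (Fin n) K) :
    (∃ B C : Matrix (Fin n) (Fin n) K,
      (IsUnit B ∧ B.IsCyclicMatrix) ∧ (IsUnit C ∧ C.IsCyclicMatrix) ∧ A = B + C) ∧
    (∃ B C : Matrix (Fin n) (Fin n) K,
      (IsUnit B ∧ B.IsSemisimpleMatrix) ∧ (IsUnit C ∧ C.IsSemisimpleMatrix) ∧ A = B + C) := by
  refine ⟨exists_add_isUnit_isCyclicMatrix hK A, ?_⟩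
  have hA : IsSumOfSeparableUnits K A := by
    simpa using
      (isSumOfSeparableUnits_end hK (toLinAlgEquiv' A)).map LinearMap.toMatrixAlgEquiv'.toAlgHom
  obtain ⟨B, C, ⟨hB, hB'⟩, ⟨hC, hC'⟩, hBC⟩ := hA
  exact ⟨B, C, ⟨hB, isSemisimpleMatrix_of_isSeparable hB'⟩,
    ⟨hC, isSemisimpleMatrix_of_isSeparable hC'⟩, hBC⟩

theorem theorem1p5 {F : Type*} [Field F] [Fintype F] (hq : 3 ≤ Fintype.card F)
    (n : ℕ) (hn : 2 ≤ n) (A : Matrix (Fin n) (Fin n) F) :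
    (∃ B C : Matrix (Fin n) (Fin n) F,
      (IsUnit B ∧ B.IsCyclicMatrix) ∧ (IsUnit C ∧ C.IsCyclicMatrix) ∧ A = B + C) ∧
    (∃ B C : Matrix (Fin n) (Fin n) F,
      (IsUnit B ∧ B.IsSemisimpleMatrix) ∧ (IsUnit C ∧ C.IsSemisimpleMatrix) ∧ A = B + C) :=
  theorem1p5_general (by rw [Cardinal.mk_fintype]; exact_mod_cast hq) A
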